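/- Let $A\in\mathbb{Z}^{m\times d}$ satisfy $\ker_{\mathbb{Z}}(A)\cap\mathbb{N}^d=\{0\}$, let $\mathbb{N}A\subseteq\mathbb{Z}^m$ be the semigroup (with $0$) generated by the columns of $A$, and for $b\in\mathbb{Z}^m$ let $\mathcal{F}_{A,b}=\{u\in\mathbb{N}^d: Au=b\}$, which is a finite set. For a finite set $\mathcal{M}\subset\ker_{\mathbb{Z}}(A)$, the fiber graph $\mathcal{F}_{A,b}(\mathcal{M})$ is the graph on $\mathcal{F}_{A,b}$ in which $u,v$ are joined by an edge if $u-v\in\pm\mathcal{M}$, and in which every node $w$ gets an additional loop for every $m\in\pm\mathcal{M}$ with $w+m\notin\mathcal{F}_{A,b}$. The set $\mathcal{M}$ is a Markov basis for $A$ if $\mathcal{F}_{A,b}(\mathcal{M})$ is connected for all $b\in\mathbb{N}A$. The simple walk on a finite graph $G=(V,E)$ (loops and multiple edges allowed) has transition matrix $S^G$, where $S^G_{vw}$ is the number of edges with endpoints $v,w$ divided by the number of edges incident to $v$ (a loop being counted once). A sequence $(G_i)_{i\in\mathbb{N}}$ of finite graphs $G_i=(V_i,E_i)$ is rapidly mixing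 if there is a polynomial $f\in\mathbb{Q}[t]$ with nonnegative coefficients such that for all $i\in\mathbb{N}$ one has $f(\log|V_i|)>0$ and $\lambda_i\le 1-\frac{1}{f(\log|V_i|)}$, where $\lambda_i$ is the second largest eigenvalue modulus of $S^{G_i}$, eigenvalues being counted with multiplicity ($\lambda_i:=0$ if $|V_i|=1$). A sequence $(b_i)_{i\in\mathbb{N}}$ in $\mathbb{N}A$ has a meaningful parametrization if there is $q\in\mathbb{Q}[t]$ with $|\mathcal{F}_{A,b_i}|\le q(i)$ for all $i\in\mathbb{N}$. A sequence $(b_i)_{i\in\mathbb{N}}$ is dominated if there is $b\in\mathbb{N}A$ such that the polytope $\{x\in\mathbb{Q}_{\ge0}^d: Ax=b\}$ has positive dimension, $b_i-i\cdot b\in\mathbb{N}A$ for all $i\in\mathbb{N}$, and there are $u\in\mathcal{F}_{A,b}$ and, for each $i\in\mathbb{N}$, $w_i\in\mathcal{F}_{A,b_i-i\cdot b}$ with $\operatorname{supp}(w_i)\subseteq\operatorname{supp}(u)$. Corollary. Let $\mathcal{M}\subset\ker_{\mathbb{Z}}(A)$ be a Markov basis for $A$ and let $(b_i)_{i\in\mathbb{N}}$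 be a sequence in $\mathbb{N}A$ with a meaningful parametrization. Suppose that there is a polynomial $p\in\mathbb{Q}[t]$ with $p(\mathbb{N})\subseteq\mathbb{N}$ such that $(b_{p(i)})_{i\in\mathbb{N}}$ is dominated. Then $(\mathcal{F}_{A,b_i}(\mathcal{M}))_{i\in\mathbb{N}}$ is not rapidly mixing. -/

import Mathlib

noncomputable section

namespace FiberWalk

open Polynomial

/-- An undirected graph on `V`, possibly with loops and multiple edges: `edgeCount v w` is the
number of edges with endpoints `v` and `w` (each loop at `v` counts once in `edgeCount v v`). -/
structure MultiGraph (V : Type*) where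
  edgeCount : V → V → ℕ
  symm : ∀ v w, edgeCount v w = edgeCount w v

namespace MultiGraph

variable {V : Type*} (G : MultiGraph V)

/-- There is a path between any two nodes (and there is at least one node). -/
def IsConnected : Prop :=
  (SimpleGraph.fromRel fun v w => 0 < G.edgeCount v w).Connected

/-- The number of edges incident to `v`. -/
def degree [Fintype V] (v : V) : ℕ := ∑ w, G.edgeCount v w

/-- The transition matrix `S^G` of the simple walk on `G`. -/
def simpleWalk [Fintype V] : Matrix V V ℝ :=
  Matrix.of fun v w => (G.edgeCount v w : ℝ) / (G.degree v : ℝ)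

end MultiGraph

/-- The second largest eigenvalue modulus of a square matrix: list the moduli of all complex
eigenvalues, with multiplicity, in decreasing order and take the second entry. On a one-point
index set, where there is no second eigenvalue, the value is `0`. -/
def slem {V : Type*} [Fintype V] [DecidableEq V] (S : Matrix V V ℝ) : ℝ :=
  ((((S.map (algebraMap ℝ ℂ)).charpoly.roots.map fun z : ℂ => ‖z‖).sort (· ≥ ·)).getD 1 0)

/-- A sequence of finite graphs is rapidly mixing if, for some polynomial `p` with nonnegative
rational coefficients, `λ_i ≤ 1 - 1 / p (log |V_i|)` for all `i`. The condition that
`p (log |V_i|)` is positive makes the quotient meaningful. -/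
def RapidlyMixing {V : ℕ → Type*} [∀ i, Fintype (V i)] [∀ i, DecidableEq (V i)]
    (G : ∀ i, MultiGraph (V i)) : Prop :=
  ∃ p : ℚ[X], (∀ n, 0 ≤ p.coeff n) ∧
    ∀ i, 0 < aeval (Real.log (Fintype.card (V i))) p ∧
      slem (G i).simpleWalk ≤ 1 - 1 / aeval (Real.log (Fintype.card (V i))) p

/-- The set `±M`. -/
def plusMinus {d : ℕ} (M : Finset (Fin d → ℤ)) : Finset (Fin d → ℤ) :=
  M ∪ M.image fun m => -m

theorem neg_mem_plusMinus {d : ℕ} {M : Finset (Fin d → ℤ)} {x : Fin d → ℤ} :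
    -x ∈ plusMinus M ↔ x ∈ plusMinus M := by
  have h : ∀ y : Fin d → ℤ, y ∈ plusMinus M → -y ∈ plusMinus M := by
    intro y hy
    simp only [plusMinus, Finset.mem_union, Finset.mem_image] at hy ⊢
    rcases hy with hy | ⟨m, hm, rfl⟩
    · exact Or.inr ⟨y, hy, rfl⟩
    · left; simpa using hm
  exact ⟨fun hx => by simpa using h _ hx, h x⟩

/-- The fiber graph `F(M)`: there is an edge between `u` and `v` if `u - v ∈ ±M`, and every node
`u` gets an additional loop for every `m ∈ ±M` with `u + m ∉ F`. -/
def fiberGraph {d : ℕ} (F M : Finset (Fin d → ℤ)) : MultiGraph F where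
  edgeCount u v :=
    (if u.1 - v.1 ∈ plusMinus M then 1 else 0) +
      (if u = v then ((plusMinus M).filter fun m => u.1 + m ∉ F).card else 0)
  symm u v := by
    have h1 : u.1 - v.1 ∈ plusMinus M ↔ v.1 - u.1 ∈ plusMinus M := by
      rw [← neg_mem_plusMinus, neg_sub]
    congr 1
    · simp only [h1]
    · by_cases h : u = v
      · subst h; rfl
      · rw [if_neg h, if_neg (Ne.symm h)]

/-- The condition `ker_ℤ(A) ∩ ℕ^d = {0}`. -/
def FiberDefining {m d : ℕ} (A : Matrix (Fin m) (Fin d) ℤ) : Prop :=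
  ∀ u : Fin d → ℤ, 0 ≤ u → A.mulVec u = 0 → u = 0

/-- The affine semigroup `ℕA` generated by the columns of `A`. -/
def semigroup {m d : ℕ} (A : Matrix (Fin m) (Fin d) ℤ) : AddSubmonoid (Fin m → ℤ) :=
  AddSubmonoid.closure (Set.range A.col)

/-- The fiber `{u ∈ ℕ^d : A u = b}`, as a set of nonnegative integer vectors. -/
def fiberSet {m d : ℕ} (A : Matrix (Fin m) (Fin d) ℤ) (b : Fin m → ℤ) : Set (Fin d → ℤ) :=
  {u | 0 ≤ u ∧ A.mulVec u = b}

theorem finite_fiberSet {m d : ℕ} {A : Matrix (Fin m) (Fin d) ℤ} (hA : FiberDefining A)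
    (b : Fin m → ℤ) : (fiberSet A b).Finite := by
  have hT : {v : Fin d → ℕ | A.mulVec (fun j => (v j : ℤ)) = b}.Finite := by
    refine WellQuasiOrderedLE.finite_of_isAntichain ?_
    intro v hv w hw hne hle
    apply hne
    have h0 : (fun j => (w j : ℤ)) - (fun j => (v j : ℤ)) = 0 := by
      refine hA _ (fun j => ?_) ?_
      · simpa using hle j
      · rw [Matrix.mulVec_sub, hv, hw, sub_self]
    funext j
    have := congrFun h0 j
    simp only [Pi.sub_apply, Pi.zero_apply] at this
    omega
  refine (hT.image fun v j => (v j : ℤ)).subset ?_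
  rintro u ⟨hu, hb⟩
  have h : (fun j => ((u j).toNat : ℤ)) = u := funext fun j => Int.toNat_of_nonneg (hu j)
  exact ⟨fun j => (u j).toNat, (congrArg A.mulVec h).trans hb, h⟩

/-- The fiber of `b` as a finite set. -/
def fiber {m d : ℕ} (A : Matrix (Fin m) (Fin d) ℤ) (hA : FiberDefining A) (b : Fin m → ℤ) :
    Finset (Fin d → ℤ) :=
  (finite_fiberSet hA b).toFinset

/-- The `ℚ`-relaxation `{x ∈ ℚ^d : x ≥ 0, A x = b}` of the fiber of `b`. -/
def relaxedFiber {m d : ℕ} (A : Matrix (Fin m) (Fin d) ℤ) (b : Fin m → ℤ) : Set (Fin d → ℚ) :=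
  {x | 0 ≤ x ∧ (A.map (Int.cast : ℤ → ℚ)).mulVec x = fun i => (b i : ℚ)}

/-- The (affine) dimension of the `ℚ`-relaxation of the fiber of `b`. -/
def relaxedDim {m d : ℕ} (A : Matrix (Fin m) (Fin d) ℤ) (b : Fin m → ℤ) : ℕ :=
  Module.finrank ℚ (vectorSpan ℚ (relaxedFiber A b))

/-- A finite set `M` is a Markov basis for `A` if it consists of elements of `ker_ℤ(A)` and the
fiber graph of every `b ∈ ℕA` is connected. -/
def IsMarkovBasis {m d : ℕ} (A : Matrix (Fin m) (Fin d) ℤ) (hA : FiberDefining A)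
    (M : Finset (Fin d → ℤ)) : Prop :=
  (∀ v ∈ M, A.mulVec v = 0) ∧
    ∀ b ∈ semigroup A, (fiberGraph (fiber A hA b) M).IsConnected

/-- A sequence has a meaningful parametrization if the fiber sizes are bounded by a polynomial
in the index. -/
def MeaningfulParametrization {m d : ℕ} (A : Matrix (Fin m) (Fin d) ℤ) (hA : FiberDefining A)
    (b : ℕ → Fin m → ℤ) : Prop :=
  ∃ q : ℚ[X], ∀ i : ℕ, ((fiber A hA (b i)).card : ℚ) ≤ q.eval (i : ℚ)

/-- A sequence `(b_i)` is dominated if there is `c ∈ ℕA`, whose relaxed fiber has positive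
dimension, such that `b_i - i c ∈ ℕA` for all `i`, and if there are `u` in the fiber of `c` and
`w_i` in the fiber of `b_i - i c` with `supp w_i ⊆ supp u` for all `i`. -/
def Dominated {m d : ℕ} (A : Matrix (Fin m) (Fin d) ℤ) (b : ℕ → Fin m → ℤ) : Prop :=
  ∃ c ∈ semigroup A, 0 < relaxedDim A c ∧
    (∀ i : ℕ, b i - i • c ∈ semigroup A) ∧
    ∃ u ∈ fiberSet A c, ∀ i : ℕ, ∃ w ∈ fiberSet A (b i - i • c),
      Function.support w ⊆ Function.support u

end FiberWalk

end

namespace FiberWalk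

open Polynomial Filter

/-! ### Spectral bound: a zero entry of `S ^ t` forces a small gap. -/

section SecondEigenvalue

/-! Moves change coordinates by a bounded amount, so a wide fiber has a large diameter, and a large
diameter limits the spectral gap. In a dominated sequence, two points of the relaxed fiber of `c`,
scaled up and translated, give fibers of linearly growing width (`Dominated.exists_le_abs_sub`).
Hence, along suitable indices, some pair of nodes is not joined in `t` steps. The walk is symmetric
because all degrees are equal, and comparing the stationary term of `S ^ t` with the remaining
spectrum gives `t * (1 - slem S) ≤ log |V|` (`mul_one_sub_slem_le_log_card`). Rapid mixing by `f`
would give `t ≤ log |V| * f (log |V|)`. But `|V|` is at most polynomial in `t`, so the right side is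
polylogarithmic in `t`: a contradiction for large `t`. -/

theorem card_filter_sort_getD_one_lt (s : Multiset ℝ) :
    (s.filter fun x => (s.sort (· ≥ ·)).getD 1 0 < x).card ≤ 1 := by
  have hp := s.pairwise_sort (· ≥ ·)
  have he := s.sort_eq (· ≥ ·)
  generalize s.sort (· ≥ ·) = L at hp he
  subst he
  match L, hp with
  | [], _ => simp
  | [a], _ => exact (Multiset.card_le_card (Multiset.filter_le _ _)).trans (by simp)
  | a :: c :: t, hp =>
    have hc : ∀ x ∈ c :: t, ¬ c < x := by
      intro x hx
      rcases List.mem_cons.1 hx with rfl | hx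
      · exact lt_irrefl _
      · exact not_lt.2 ((List.pairwise_cons.1 (List.pairwise_cons.1 hp).2).1 x hx)
    have hnil : (c :: t).filter (fun x => decide (c < x)) = [] := by
      simpa [List.filter_eq_nil_iff] using hc
    have hget : (a :: c :: t).getD 1 0 = c := rfl
    rw [hget, Multiset.filter_coe, Multiset.coe_card, List.filter_cons, hnil]
    split_ifs <;> simp

variable {V : Type*} [Fintype V] [DecidableEq V] {S : Matrix V V ℝ}

theorem slem_nonneg (S : Matrix V V ℝ) : 0 ≤ slem S := by
  unfold slem
  set s := (S.map (algebraMap ℝ ℂ)).charpoly.roots.map fun z : ℂ => ‖z‖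
  by_cases h : 1 < (s.sort (· ≥ ·)).length
  · rw [List.getD_eq_getElem _ _ h]
    have hm : (s.sort (· ≥ ·))[1] ∈ s := (Multiset.mem_sort _).1 (List.getElem_mem h)
    obtain ⟨z, -, hz⟩ := Multiset.mem_map.1 hm
    exact (norm_nonneg z).trans_eq hz
  · rw [List.getD_eq_default _ _ (not_lt.1 h)]

theorem card_slem_lt_abs_eigenvalues (hS : S.IsHermitian) :
    (Finset.univ.filter fun j => slem S < |hS.eigenvalues j|).card ≤ 1 := by
  have hr : ((S.map (algebraMap ℝ ℂ)).charpoly.roots.map fun z : ℂ => ‖z‖) =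
      Finset.univ.val.map fun j => |hS.eigenvalues j| := by
    rw [Matrix.charpoly_map, hS.charpoly_eq, Polynomial.map_prod, Polynomial.roots_prod]
    · simp [Multiset.map_map]
    · simp [Finset.prod_ne_zero_iff, Polynomial.X_sub_C_ne_zero]
  have h := card_filter_sort_getD_one_lt (Finset.univ.val.map fun j => |hS.eigenvalues j|)
  rw [Multiset.filter_map, Multiset.card_map, ← hr] at h
  exact h

/-- At most one eigenvalue can exceed the second entry of the sorted list, and `j₀` already does. -/
theorem exists_abs_eigenvalues_le_slem (hS : S.IsHermitian) (hlt : slem S < 1) {j₀ : V}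
    (h₀ : hS.eigenvalues j₀ = 1) {j : V} (hj : j ≠ j₀) : |hS.eigenvalues j| ≤ slem S := by
  by_contra! h
  refine hj (Finset.card_le_one.1 (card_slem_lt_abs_eigenvalues hS) _ ?_ _ ?_)
  · simpa using h
  · simpa [h₀] using hlt

/-- If a symmetric random walk cannot get from `u` to `v` in exactly `t` steps, then the second
largest eigenvalue modulus is at least `|V| ^ (-1 / t)`. -/
theorem one_le_card_mul_slem_pow (hS : S.IsHermitian) (h1 : ∀ u, ∑ v, S u v = 1)
    (hlt : slem S < 1) {t : ℕ} {u v : V} (h0 : (S ^ t) u v = 0) :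
    1 ≤ (Fintype.card V : ℝ) * slem S ^ t := by
  set U : Matrix V V ℝ := (hS.eigenvectorUnitary : Matrix V V ℝ) with hU
  set μ := hS.eigenvalues with hμ
  have hUU : U * U.transpose = 1 := Unitary.coe_mul_star_self hS.eigenvectorUnitary
  have hUU' : U.transpose * U = 1 := Unitary.coe_star_mul_self hS.eigenvectorUnitary
  have hSU : S * U = U * Matrix.diagonal μ := by
    ext x j
    have := congrFun (hS.mulVec_eigenvectorBasis j) x
    rw [Matrix.mul_diagonal, Matrix.mul_apply]
    simpa [Matrix.mulVec, dotProduct, hU, mul_comm] using this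
  have hpow : ∀ n : ℕ, S ^ n * U = U * Matrix.diagonal fun j => μ j ^ n := by
    intro n
    induction n with
    | zero => simp
    | succ n ih =>
      rw [pow_succ, Matrix.mul_assoc, hSU, ← Matrix.mul_assoc, ih, Matrix.mul_assoc,
        Matrix.diagonal_mul_diagonal]
      simp [pow_succ]
  have hentry : (S ^ t) u v = ∑ j, μ j ^ t * (U u j * U v j) := by
    have : S ^ t = U * Matrix.diagonal (fun j => μ j ^ t) * U.transpose := by
      rw [← hpow, Matrix.mul_assoc, hUU, Matrix.mul_one]
    rw [this, Matrix.mul_apply]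
    refine Finset.sum_congr rfl fun j _ => ?_
    rw [Matrix.mul_diagonal, Matrix.transpose_apply]
    ring
  have hrow : ∀ x, ∑ j, U x j * U x j = 1 := by
    intro x
    have := congrFun (congrFun hUU x) x
    simpa [Matrix.mul_apply] using this
  have hcol : ∀ j, ∑ x, U x j * U x j = 1 := by
    intro j
    have := congrFun (congrFun hUU' j) j
    simpa [Matrix.mul_apply] using this
  have hsymm : ∀ x y, S x y = S y x := fun x y => (hS.apply x y).symm
  have hsum : ∀ j, μ j * ∑ x, U x j = ∑ x, U x j := by
    intro j
    have hx : ∀ x, ∑ y, S x y * U y j = U x j * μ j := by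
      intro x
      have := congrFun (congrFun hSU x) j
      rwa [Matrix.mul_diagonal, Matrix.mul_apply] at this
    calc μ j * ∑ x, U x j = ∑ x, ∑ y, S x y * U y j := by
          rw [Finset.mul_sum]
          exact Finset.sum_congr rfl fun x _ => by rw [hx, mul_comm]
      _ = ∑ y, (∑ x, S y x) * U y j := by
          rw [Finset.sum_comm]
          refine Finset.sum_congr rfl fun y _ => ?_
          rw [Finset.sum_mul]
          exact Finset.sum_congr rfl fun x _ => by rw [hsymm]
      _ = ∑ x, U x j := by simp [h1]
  -- The all-ones vector expanded in the eigenbasis; some coefficient is nonzero, and by `hsum` its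
  -- eigenvalue is 1.
  have hone : ∀ x, ∑ j, (∑ y, U y j) * U x j = 1 := by
    intro x
    simp_rw [Finset.sum_mul]
    rw [Finset.sum_comm]
    have hxy : ∀ y, ∑ j, U y j * U x j = if y = x then 1 else 0 := by
      intro y
      have := congrFun (congrFun hUU y) x
      simpa [Matrix.mul_apply, Matrix.one_apply] using this
    simp [hxy]
  obtain ⟨j₀, hj₀⟩ : ∃ j₀, ∑ y, U y j₀ ≠ 0 := by
    by_contra! h
    simpa [h] using hone u
  have hμ₀ : μ j₀ = 1 := mul_right_cancel₀ hj₀ (by rw [hsum, one_mul])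
  have hle : ∀ j, j ≠ j₀ → |μ j| ≤ slem S := fun j hj =>
    exists_abs_eigenvalues_le_slem hS hlt hμ₀ hj
  have hzero : ∀ j, j ≠ j₀ → ∑ y, U y j = 0 := by
    intro j hj
    by_contra h
    have h' : μ j = 1 := mul_right_cancel₀ h (by rw [hsum, one_mul])
    have := hle j hj
    rw [h', abs_one] at this
    exact absurd this (not_le.2 hlt)
  -- Only the `j₀` term of the expansion survives, so the `j₀` eigenvector is constant, with squared
  -- entries `1 / |V|`.
  have hconst : ∀ x, (∑ y, U y j₀) * U x j₀ = 1 := by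
    intro x
    rw [← Finset.sum_eq_single (f := fun j => (∑ y, U y j) * U x j) j₀ (fun j _ hj => ?_)
      fun h => absurd (Finset.mem_univ j₀) h]
    · exact hone x
    · simp only [hzero j hj, zero_mul]
  have hUc : ∀ x, U x j₀ = U u j₀ := fun x =>
    mul_left_cancel₀ hj₀ ((hconst x).trans (hconst u).symm)
  have hcard : (Fintype.card V : ℝ) * (U u j₀ * U u j₀) = 1 := by
    rw [← hcol j₀]
    simp [hUc]
  -- As the entry vanishes, the other eigenvalues must cancel the stationary term `1 / |V|`.
  have hrest : U u j₀ * U u j₀ = -∑ j ∈ Finset.univ.erase j₀, μ j ^ t * (U u j * U v j) := by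
    rw [hentry, ← Finset.add_sum_erase _ _ (Finset.mem_univ j₀), hμ₀, one_pow, one_mul, hUc v]
      at h0
    linarith
  have hbound : U u j₀ * U u j₀ ≤ slem S ^ t := by
    rw [hrest]
    have hs := pow_nonneg (slem_nonneg S) t
    calc -∑ j ∈ Finset.univ.erase j₀, μ j ^ t * (U u j * U v j)
        ≤ ∑ j ∈ Finset.univ.erase j₀, slem S ^ t * ((U u j * U u j + U v j * U v j) / 2) := by
          rw [← Finset.sum_neg_distrib]
          refine Finset.sum_le_sum fun j hj => ?_
          have h2 : |μ j ^ t| ≤ slem S ^ t := by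
            rw [abs_pow]
            exact pow_le_pow_left₀ (abs_nonneg _) (hle j (Finset.ne_of_mem_erase hj)) t
          have h3 : |U u j * U v j| ≤ (U u j * U u j + U v j * U v j) / 2 := by
            rw [abs_le]
            constructor <;> nlinarith [sq_nonneg (U u j + U v j), sq_nonneg (U u j - U v j)]
          calc -(μ j ^ t * (U u j * U v j)) ≤ |μ j ^ t * (U u j * U v j)| := neg_le_abs _
            _ = |μ j ^ t| * |U u j * U v j| := abs_mul _ _
            _ ≤ _ := mul_le_mul h2 h3 (abs_nonneg _) hs
      _ ≤ ∑ j, slem S ^ t * ((U u j * U u j + U v j * U v j) / 2) := by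
          refine Finset.sum_le_sum_of_subset_of_nonneg (Finset.erase_subset _ _) fun j _ _ => ?_
          exact mul_nonneg hs (by nlinarith [mul_self_nonneg (U u j), mul_self_nonneg (U v j)])
      _ = slem S ^ t := by
          rw [← Finset.mul_sum, ← Finset.sum_div, Finset.sum_add_distrib, hrow, hrow]
          ring
  rw [← hcard]
  exact mul_le_mul_of_nonneg_left hbound (Nat.cast_nonneg _)

theorem mul_one_sub_slem_le_log_card (hS : S.IsHermitian) (h1 : ∀ u, ∑ v, S u v = 1)
    (hlt : slem S < 1) {t : ℕ} {u v : V} (h0 : (S ^ t) u v = 0) :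
    t * (1 - slem S) ≤ Real.log (Fintype.card V) := by
  have hc : (0 : ℝ) < Fintype.card V := by
    exact_mod_cast Fintype.card_pos_iff.2 ⟨u⟩
  rw [Real.le_log_iff_exp_le hc]
  have hle : slem S ^ t ≤ Real.exp (-(t * (1 - slem S))) := by
    calc slem S ^ t ≤ Real.exp (-(1 - slem S)) ^ t := by
          refine pow_le_pow_left₀ (slem_nonneg S) ?_ t
          have := Real.one_sub_le_exp_neg (1 - slem S)
          linarith
      _ = _ := by rw [← Real.exp_nat_mul]; ring_nf
  have h := (one_le_card_mul_slem_pow hS h1 hlt h0).trans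
    (mul_le_mul_of_nonneg_left hle hc.le)
  rw [Real.exp_neg] at h
  have hp := Real.exp_pos (t * (1 - slem S))
  rwa [← div_eq_mul_inv, one_le_div hp] at h

end SecondEigenvalue

/-! ### The simple walk on a fiber graph. -/

section FiberGraph

variable {d : ℕ} {F M : Finset (Fin d → ℤ)}

/-- Each move either stays in the fiber and gives an edge, or leaves it and gives a loop. This
regularity makes the walk symmetric. -/
theorem degree_fiberGraph (v : F) : (fiberGraph F M).degree v = (plusMinus M).card := by
  have h : (Finset.univ.filter fun w : F => v.1 - w.1 ∈ plusMinus M).card =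
      ((plusMinus M).filter fun m => v.1 + m ∈ F).card := by
    refine Finset.card_bij (fun w _ => w.1 - v.1) ?_ ?_ ?_
    · intro w hw
      have hw' := (Finset.mem_filter.1 hw).2
      rw [← neg_mem_plusMinus, neg_sub] at hw'
      exact Finset.mem_filter.2 ⟨hw', by simp⟩
    · intro w _ w' _ hww
      exact Subtype.ext (sub_left_injective hww)
    · intro m hm
      obtain ⟨hm, hF⟩ := Finset.mem_filter.1 hm
      refine ⟨⟨v.1 + m, hF⟩, Finset.mem_filter.2 ⟨Finset.mem_univ _, ?_⟩, by simp⟩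
      simpa [neg_mem_plusMinus] using hm
  have hd : (fiberGraph F M).degree v =
      (Finset.univ.filter fun w : F => v.1 - w.1 ∈ plusMinus M).card +
        ((plusMinus M).filter fun m => v.1 + m ∉ F).card := by
    simp [MultiGraph.degree, fiberGraph, Finset.sum_add_distrib]
  rw [hd, h]
  exact Finset.card_filter_add_card_filter_not _

theorem isHermitian_simpleWalk_fiberGraph : (fiberGraph F M).simpleWalk.IsHermitian := by
  ext u v
  simp [MultiGraph.simpleWalk, degree_fiberGraph, (fiberGraph F M).symm u v]

theorem sum_simpleWalk_fiberGraph (hM : (plusMinus M).Nonempty) (u : F) :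
    ∑ v, (fiberGraph F M).simpleWalk u v = 1 := by
  have h0 : ((fiberGraph F M).degree u : ℝ) ≠ 0 := by
    rw [degree_fiberGraph]
    exact_mod_cast hM.card_ne_zero
  simp only [MultiGraph.simpleWalk, Matrix.of_apply]
  rw [← Finset.sum_div, div_eq_one_iff_eq h0]
  simp [MultiGraph.degree]

theorem abs_sub_le_of_simpleWalk_pow_ne_zero {K : ℤ} {k : Fin d}
    (hK : ∀ m ∈ plusMinus M, |m k| ≤ K) (hK0 : 0 ≤ K) (t : ℕ) (u v : F)
    (h : ((fiberGraph F M).simpleWalk ^ t) u v ≠ 0) : |u.1 k - v.1 k| ≤ K * t := by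
  induction t generalizing v with
  | zero =>
    have huv : u = v := by
      by_contra huv
      exact h (by simp [huv])
    simp [huv]
  | succ t ih =>
    rw [pow_succ, Matrix.mul_apply] at h
    obtain ⟨w, -, hw⟩ := Finset.exists_ne_zero_of_sum_ne_zero h
    have h1 := ih w (left_ne_zero_of_mul hw)
    have h2 : |w.1 k - v.1 k| ≤ K := by
      by_cases hwv : w.1 - v.1 ∈ plusMinus M
      · exact hK _ hwv
      · by_cases he : w = v
        · simpa [he] using hK0
        · exact absurd (right_ne_zero_of_mul hw) (by
            simp [MultiGraph.simpleWalk, fiberGraph, hwv, he])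
    have h3 := abs_sub_le (u.1 k) (w.1 k) (v.1 k)
    push_cast
    linarith

/-- Excludes degree 0, where division by zero would make the rows of the walk vanish instead of
summing to 1. -/
theorem plusMinus_nonempty_of_isConnected (h : (fiberGraph F M).IsConnected) {u v : F}
    (huv : u ≠ v) : (plusMinus M).Nonempty := by
  by_contra hM
  rw [Finset.not_nonempty_iff_eq_empty] at hM
  have hbot : (SimpleGraph.fromRel fun v w => 0 < (fiberGraph F M).edgeCount v w) = ⊥ := by
    ext a c
    simp [fiberGraph, hM]
  have hc : (⊥ : SimpleGraph F).Connected := hbot ▸ h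
  have hp := hc.preconnected u v
  exact huv (by simpa using hp)

end FiberGraph

/-! ### Polylogarithmic versus linear growth. -/

section Growth

theorem aeval_le_aeval_of_coeff_nonneg {f : ℚ[X]} (hf : ∀ n, 0 ≤ f.coeff n) {x y : ℝ}
    (hx : 0 ≤ x) (hxy : x ≤ y) : aeval x f ≤ aeval y f := by
  rw [aeval_eq_sum_range, aeval_eq_sum_range]
  refine Finset.sum_le_sum fun n _ => ?_
  rw [Rat.smul_def, Rat.smul_def]
  exact mul_le_mul_of_nonneg_left (pow_le_pow_left₀ hx hxy n) (by exact_mod_cast hf n)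

theorem isLittleO_eval_log_natCast (P : ℝ[X]) :
    (fun t : ℕ => P.eval (Real.log t)) =o[atTop] fun t : ℕ => (t : ℝ) := by
  have h : (fun x => P.eval x) =O[atTop] fun x => ((X : ℝ[X]) ^ P.natDegree).eval x :=
    Polynomial.isBigO_atTop_of_degree_le _ _ (by simp)
  simp only [eval_pow, eval_X] at h
  have h2 := (h.comp_tendsto Real.tendsto_log_atTop).trans_isLittleO
    (Real.isLittleO_pow_log_id_atTop (n := P.natDegree))
  exact h2.comp_tendsto tendsto_natCast_atTop_atTop

theorem eventually_eval_natCast_le_pow (Q : ℚ[X]) :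
    ∀ᶠ t : ℕ in atTop, ((Q.eval (t : ℚ) : ℚ) : ℝ) ≤ (t : ℝ) ^ (Q.natDegree + 1) := by
  set P : ℝ[X] := Q.map (algebraMap ℚ ℝ) with hP
  have h : (fun x => P.eval x) =O[atTop] fun x => ((X : ℝ[X]) ^ Q.natDegree).eval x :=
    Polynomial.isBigO_atTop_of_degree_le _ _ (by simp [hP])
  simp only [eval_pow, eval_X] at h
  obtain ⟨C, hC⟩ := h.bound
  -- Once `t ≥ C`, the extra power of `t` absorbs the constant.
  filter_upwards [tendsto_natCast_atTop_atTop.eventually hC,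
    tendsto_natCast_atTop_atTop.eventually (eventually_ge_atTop C)] with t ht htC
  have hev : ((Q.eval (t : ℚ) : ℚ) : ℝ) = P.eval (t : ℝ) := by
    rw [hP, eval_map_algebraMap]
    have := aeval_algebraMap_apply ℝ (t : ℚ) Q
    simpa using this.symm
  rw [hev]
  calc P.eval (t : ℝ) ≤ ‖P.eval (t : ℝ)‖ := Real.le_norm_self _
    _ ≤ C * ‖(t : ℝ) ^ Q.natDegree‖ := ht
    _ = C * (t : ℝ) ^ Q.natDegree := by rw [Real.norm_of_nonneg (by positivity)]
    _ ≤ t * (t : ℝ) ^ Q.natDegree := by gcongr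
    _ = _ := by ring

theorem eventually_log_mul_aeval_log_lt {f : ℚ[X]} (hf : ∀ n, 0 ≤ f.coeff n) (Q : ℚ[X]) :
    ∀ᶠ t : ℕ in atTop, ∀ n : ℕ, 1 ≤ n → (n : ℚ) ≤ Q.eval (t : ℚ) →
      Real.log n * aeval (Real.log n) f < t := by
  set E : ℕ := Q.natDegree + 1
  set P : ℝ[X] := ((X * f).map (algebraMap ℚ ℝ)).comp (C (E : ℝ) * X) with hP
  have hXf : ∀ n, 0 ≤ (X * f).coeff n := by
    rintro (_ | n)
    · simp
    · simpa using hf n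
  -- Since `n ≤ t ^ E`, monotonicity of `X * f` replaces `log n` by `E * log t`, uniformly in `n`.
  filter_upwards [eventually_eval_natCast_le_pow Q,
    (isLittleO_eval_log_natCast P).bound (c := 1 / 2) (by norm_num),
    eventually_ge_atTop 1] with t hQ ho ht n hn hnQ
  have hn' : (1 : ℝ) ≤ n := by exact_mod_cast hn
  have ht' : (1 : ℝ) ≤ t := by exact_mod_cast ht
  have hlog : Real.log n ≤ E * Real.log t := by
    rw [← Real.log_pow]
    refine Real.log_le_log (by linarith) (le_trans ?_ hQ)
    exact_mod_cast hnQ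
  have hmono := aeval_le_aeval_of_coeff_nonneg hXf (Real.log_nonneg hn') hlog
  have hPe : P.eval (Real.log t) = aeval (E * Real.log t) (X * f) := by
    simp [hP, eval_map_algebraMap]
  rw [Real.norm_of_nonneg (by linarith : (0 : ℝ) ≤ (t : ℝ)), hPe] at ho
  have h1 := (Real.le_norm_self _).trans ho
  have h2 : aeval (Real.log n) (X * f) = Real.log n * aeval (Real.log n) f := by simp
  linarith

end Growth

/-! ### Linear width of dominated fibers. -/

section Dominated

theorem exists_natCast_mul_eq_intCast {ι : Type*} [Fintype ι] (x : ι → ℚ) :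
    ∃ N : ℕ, 0 < N ∧ ∃ z : ι → ℤ, ∀ k, (z k : ℚ) = N * x k := by
  classical
  refine ⟨∏ k, (x k).den, Finset.prod_pos fun k _ => (x k).den_pos,
    fun k => (∏ l ∈ Finset.univ.erase k, ((x l).den : ℤ)) * (x k).num, fun k => ?_⟩
  rw [← Finset.mul_prod_erase _ _ (Finset.mem_univ k)]
  push_cast
  rw [mul_comm ((x k).den : ℚ), mul_assoc, mul_comm ((x k).den : ℚ), Rat.mul_den_eq_num]

variable {m d : ℕ} {A : Matrix (Fin m) (Fin d) ℤ}

theorem mem_fiberSet_nsmul_of_mem_relaxedFiber {c : Fin m → ℤ} {x : Fin d → ℚ}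
    (hx : x ∈ relaxedFiber A c) {N : ℕ} {z : Fin d → ℤ} (hz : ∀ k, (z k : ℚ) = N * x k) :
    z ∈ fiberSet A (N • c) := by
  obtain ⟨hx0, hxc⟩ := hx
  constructor
  · intro k
    have h : (0 : ℚ) ≤ z k := by
      rw [hz]
      exact mul_nonneg (Nat.cast_nonneg _) (hx0 k)
    exact_mod_cast h
  · funext i
    have h := congrFun hxc i
    simp only [Matrix.mulVec, dotProduct, Matrix.map_apply] at h
    have h' : ((A.mulVec z i : ℤ) : ℚ) = ((N • c) i : ℤ) := by
      simp only [Matrix.mulVec, dotProduct, Pi.smul_apply, nsmul_eq_mul]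
      push_cast
      rw [← h, Finset.mul_sum]
      exact Finset.sum_congr rfl fun k _ => by rw [hz]; ring
    exact_mod_cast h'

theorem add_mem_fiberSet {a c : Fin m → ℤ} {u v : Fin d → ℤ} (hu : u ∈ fiberSet A a)
    (hv : v ∈ fiberSet A c) : u + v ∈ fiberSet A (a + c) :=
  ⟨add_nonneg hu.1 hv.1, by rw [Matrix.mulVec_add, hu.2, hv.2]⟩

theorem nsmul_mem_fiberSet {c : Fin m → ℤ} {u : Fin d → ℤ} (hu : u ∈ fiberSet A c) (n : ℕ) :
    n • u ∈ fiberSet A (n • c) :=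
  ⟨nsmul_nonneg hu.1 n, by rw [Matrix.mulVec_smul, hu.2]⟩

/-- Along a multiple of the index, the fibers of a dominated sequence have linearly growing width
in some coordinate direction. -/
theorem Dominated.exists_le_abs_sub {b : ℕ → Fin m → ℤ} (h : Dominated A b) :
    ∃ N : ℕ, ∃ k : Fin d, ∀ j : ℕ, ∃ u ∈ fiberSet A (b (N * j)), ∃ v ∈ fiberSet A (b (N * j)),
      (j : ℤ) ≤ |u k - v k| := by
  obtain ⟨c, -, hdim, -, _, -, hw⟩ := h
  obtain ⟨x, hx, y, hy, hxy⟩ : (relaxedFiber A c).Nontrivial := by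
    by_contra hn
    rw [Set.not_nontrivial_iff] at hn
    rw [relaxedDim, vectorSpan_of_subsingleton ℚ hn, finrank_bot] at hdim
    exact lt_irrefl _ hdim
  obtain ⟨k, hk⟩ := Function.ne_iff.1 hxy
  -- One common denominator `N` clears both points at once.
  obtain ⟨N, hN, z, hz⟩ := exists_natCast_mul_eq_intCast (Sum.elim x y)
  have hzx := mem_fiberSet_nsmul_of_mem_relaxedFiber hx (z := z ∘ Sum.inl) fun k => hz (Sum.inl k)
  have hzy := mem_fiberSet_nsmul_of_mem_relaxedFiber hy (z := z ∘ Sum.inr) fun k => hz (Sum.inr k)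
  have hne : z (Sum.inl k) ≠ z (Sum.inr k) := by
    intro he
    have h2 : (z (Sum.inl k) : ℚ) = z (Sum.inr k) := by rw [he]
    rw [hz, hz] at h2
    exact hk (mul_left_cancel₀ (by exact_mod_cast hN.ne') h2)
  refine ⟨N, k, fun j => ?_⟩
  obtain ⟨w, hw, -⟩ := hw (N * j)
  -- Both scaled points are shifted by the same `w`, which cancels in their difference.
  have he : j • N • c + (b (N * j) - (N * j) • c) = b (N * j) := by
    rw [smul_smul, mul_comm j N, add_sub_cancel]
  refine ⟨j • (z ∘ Sum.inl) + w, he ▸ add_mem_fiberSet (nsmul_mem_fiberSet hzx j) hw,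
    j • (z ∘ Sum.inr) + w, he ▸ add_mem_fiberSet (nsmul_mem_fiberSet hzy j) hw, ?_⟩
  have h1 : 1 ≤ |z (Sum.inl k) - z (Sum.inr k)| := Int.one_le_abs (sub_ne_zero.2 hne)
  have h2 : (j • (z ∘ Sum.inl) + w) k - (j • (z ∘ Sum.inr) + w) k =
      j * (z (Sum.inl k) - z (Sum.inr k)) := by
    simp
    ring
  rw [h2, abs_mul, Nat.abs_cast]
  nlinarith

end Dominated

end FiberWalk

/-! ### The contradiction. -/

open FiberWalk

theorem corollaryc {m d : ℕ} (A : Matrix (Fin m) (Fin d) ℤ) (hA : FiberWalk.FiberDefining A)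
    (M : Finset (Fin d → ℤ)) (hM : FiberWalk.IsMarkovBasis A hA M)
    (b : ℕ → Fin m → ℤ) (hb : ∀ i, b i ∈ FiberWalk.semigroup A)
    (hmp : FiberWalk.MeaningfulParametrization A hA b)
    (p : Polynomial ℚ) (s : ℕ → ℕ) (hs : ∀ i : ℕ, p.eval (i : ℚ) = (s i : ℚ))
    (hdom : FiberWalk.Dominated A fun i => b (s i)) :
    ¬ FiberWalk.RapidlyMixing fun i => FiberWalk.fiberGraph (FiberWalk.fiber A hA (b i)) M := by
  rintro ⟨f, hf, hmix⟩
  obtain ⟨q, hq⟩ := hmp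
  obtain ⟨N, k, hwidth⟩ := hdom.exists_le_abs_sub
  obtain ⟨K, hK⟩ : ∃ K : ℕ, ∀ v ∈ plusMinus M, |v k| ≤ (K : ℤ) := by
    refine ⟨(plusMinus M).sup fun v => (v k).natAbs, fun v hv => ?_⟩
    rw [Int.abs_eq_natAbs]
    exact_mod_cast Finset.le_sup (f := fun v : Fin d → ℤ => (v k).natAbs) hv
  -- Width `K * t + 1` just exceeds the reach `K * t` of `t` steps; `Q` bounds the size of the fiber
  -- at the corresponding index `s (N * (K * t + 1))`.
  set Q : Polynomial ℚ := (q.comp p).comp ((N : Polynomial ℚ) * ((K : Polynomial ℚ) * Polynomial.X + 1)) with hQ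
  obtain ⟨t, ht⟩ := (eventually_log_mul_aeval_log_lt hf Q).exists
  set i := N * (K * t + 1) with hi
  obtain ⟨u, hu, v, hv, huv⟩ := hwidth (K * t + 1)
  set F := fiber A hA (b (s i)) with hF
  have hFmem : ∀ {x}, x ∈ fiberSet A (b (s i)) → x ∈ F := fun hx =>
    (finite_fiberSet hA _).mem_toFinset.2 hx
  have hfar : ((fiberGraph F M).simpleWalk ^ t) ⟨u, hFmem hu⟩ ⟨v, hFmem hv⟩ = 0 := by
    by_contra hne
    have h := abs_sub_le_of_simpleWalk_pow_ne_zero hK (Int.natCast_nonneg K) t _ _ hne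
    push_cast at huv
    exact absurd (huv.trans h) (by simp)
  have hne : (⟨u, hFmem hu⟩ : F) ≠ ⟨v, hFmem hv⟩ := by
    intro he
    have he' : u = v := congrArg Subtype.val he
    rw [he', sub_self, abs_zero] at huv
    push_cast at huv
    linarith [mul_nonneg (Int.natCast_nonneg K) (Int.natCast_nonneg t)]
  have hMne := plusMinus_nonempty_of_isConnected (hM.2 _ (hb (s i))) hne
  obtain ⟨hpos, hle⟩ : 0 < Polynomial.aeval (Real.log (Fintype.card F)) f ∧
      slem (fiberGraph F M).simpleWalk ≤
        1 - 1 / Polynomial.aeval (Real.log (Fintype.card F)) f := hmix (s i)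
  have hlt : slem (fiberGraph F M).simpleWalk < 1 := by
    have : 0 < 1 / Polynomial.aeval (Real.log (Fintype.card F)) f := one_div_pos.2 hpos
    linarith
  have hdiam := mul_one_sub_slem_le_log_card isHermitian_simpleWalk_fiberGraph
    (sum_simpleWalk_fiberGraph hMne) hlt hfar
  have hcard : (Fintype.card F : ℚ) ≤ Q.eval (t : ℚ) := by
    have h := hq (s i)
    rw [← hs, hi] at h
    simpa [hQ] using h
  have hbig := ht (Fintype.card F) (Fintype.card_pos_iff.2 ⟨⟨u, hFmem hu⟩⟩) hcard
  have h1 : (t : ℝ) * (1 / Polynomial.aeval (Real.log (Fintype.card F)) f) ≤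
      Real.log (Fintype.card F) :=
    (mul_le_mul_of_nonneg_left (by linarith) (Nat.cast_nonneg t)).trans hdiam
  rw [mul_one_div, div_le_iff₀ hpos] at h1
  linarith
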